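/- **Setting.** Let $X_0\in\{B,C,D\}$, put $\epsilon=1$ for $X_0=B,D$ and $\epsilon=-1$ for $X_0=C$. Let $T$ be a standard domino tableau with dominos $D(1),\dots,D(n)$ (in type $B$ the square $S_{11}$ is in addition labelled $0$), where $S_{ij}$ is the square in row $i\ge 1$ and column $j\ge 1$. Let $T(k)$ be the part of $T$ with labels $\le k$. $T$ is *admissible* of type $X_0$ if for all $0\le k\le n$ the shape of $T(k)$ is the partition of a nilpotent orbit of type $X_0$, i.e. it is a partition of an odd number in type $B$, of an even number in types $C$, $D$, and each $l$ with $(-1)^l=\epsilon$ occurs an even number of times as a part. Extend labels by $\mathrm{label}(S_{ij})=0$ if $i=0$ or $j=0$, and $\infty$ at the other positions outside $T$. **Types of dominos.** A horizontal domino has type $N$; a vertical domino in column $j$ has type $I^+$ if $(-1)^j=-\epsilon$ and type $I^-$ if $(-1)^j=\epsilon$. **Clusters.** The clusters are the classes of $\{1,\dots,n\}$ under the equivalence relation on $\{0,1,\dots,n\}$ generated by the following rules (so $0$ is not recorded in a cluster, but may link dominos): * $D(k)=\{S_{ij},S_{i+1,j}\}$ of type $I^-$: $k\sim \mathrm{label}(S_{i,j-1})$.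 * $D(k)=\{S_{ij},S_{i+1,j}\}$ of type $I^+$, with $i\ge2$ and $\mathrm{label}(S_{i-1,j+1})>k$: $k\sim\mathrm{label}(S_{i-1,j})$. * $D(k)=\{S_{ij},S_{i,j+1}\}$: $k\sim \mathrm{label}(S_{i,j-1})$ and, if $i\ge2$ and $\mathrm{label}(S_{i-1,j+2})>k$, also $k\sim\mathrm{label}(S_{i-1,j+1})$. In types $B$, $C$, the cluster containing $D(1)$ is called $cl(0)$. A cluster different from $cl(0)$ is *open* if the last of its squares in some row belongs to a domino of type $I^+$ or $N$. A cluster that is neither $cl(0)$ nor open is *closed*. **Cycles.** For $X=B,C$ call $S_{ij}$ *$X$-fixed* if $i+j$ is odd; for $X=D,D'$ call it $X$-fixed if $i+j$ is even. Let $S_{ij}$ be the $X$-fixed square of $D(k)$. If the other square of $D(k)$ is $S_{i+1,j}$ or $S_{i,j-1}$, then $MT(D(k))$ is $\{S_{ij},S_{i-1,j}\}$ if $\mathrm{label}(S_{i-1,j+1})>k$ and $\{S_{ij},S_{i,j+1}\}$ otherwise. If the other square is $S_{i-1,j}$ or $S_{i,j+1}$, then $MT(D(k))$ is $\{S_{ij},S_{i,j-1}\}$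 if $\mathrm{label}(S_{i+1,j-1})>k$ and $\{S_{ij},S_{i+1,j}\}$ otherwise. The *$X$-cycles* of $T$ are the classes of the equivalence relation on $\{1,\dots,n\}$ generated by $k\sim l$ whenever $MT(D(k))\cap D(l)\neq\emptyset$. **Initial cycle.** Let $\mathcal C$ be a cluster, $I_{\mathcal C}$ its domino with the smallest label, and $S_{ij}$ the left and uppermost square of $I_{\mathcal C}$. For $X=B,C$, $\mathcal C$ is an *$X$-cluster* if $i+j$ is odd; for $X=D,D'$, it is an $X$-cluster if $i+j$ is even. The *initial cycle* $\mathcal Y_{\mathcal C}$ of an $X$-cluster $\mathcal C$ is the $X$-cycle through $I_{\mathcal C}$. **Proposition.** Let $T$ be an admissible domino tableau of type $B$, $C$ or $D$, and let $\mathcal C$ be an open or closed cluster of $T$. If $\mathcal C$ is an $X$-cluster ($X\in\{B,C,D,D'\}$), then $\mathcal Y_{\mathcal C}\subseteq\mathcal C$. -/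

import Mathlib

/-! Squares are pairs `(i, j)` (row, column) of natural numbers, both numbered from `1`. -/

/-- The classical types of groups not of type `A`. -/
inductive ClassicalType
  | B | C | D
  deriving DecidableEq

/-- The sign of the bilinear form preserved by the group: orthogonal for `B`, `D`,
symplectic for `C`. -/
def ClassicalType.eps : ClassicalType → ℤ
  | .B => 1
  | .C => -1
  | .D => 1

/-- The labels `X = B, C, D, D'` of the choices of fixed and variable squares. -/
inductive GridType
  | B | C | D | D'

/-- The `X`-fixed squares: `i + j` odd for `X = B, C` and `i + j` even for `X = D, D'`. -/
def GridType.IsFixed : GridType → ℕ × ℕ → Prop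
  | .B, s => Odd (s.1 + s.2)
  | .C, s => Odd (s.1 + s.2)
  | .D, s => Even (s.1 + s.2)
  | .D', s => Even (s.1 + s.2)

/-- A multiset of positive parts is the partition of a nilpotent orbit of type `X`:
its size is the dimension of a standard representation (odd for `B`, even for `C` and `D`)
and every `l` with `(-1) ^ l = ε` occurs an even number of times as a part. -/
def IsNilpotentPartition (X : ClassicalType) (p : Multiset ℕ) : Prop :=
  (X = .B ↔ Odd p.sum) ∧ ∀ l : ℕ, (-1 : ℤ) ^ l = X.eps → Even (p.count l)

/-- A standard domino tableau with dominos labelled `1, …, n`. In type `B` the square `(1, 1)`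
carries the label `0`. The values of `label` off `squares` are irrelevant. -/
structure DominoTableau (X : ClassicalType) (n : ℕ) where
  squares : Finset (ℕ × ℕ)
  label : ℕ × ℕ → ℕ
  pos : ∀ s ∈ squares, 1 ≤ s.1 ∧ 1 ≤ s.2
  diagram : ∀ i j i' j' : ℕ, (i, j) ∈ squares → 1 ≤ i' → i' ≤ i → 1 ≤ j' → j' ≤ j →
    (i', j') ∈ squares
  monotone : ∀ i j i' j' : ℕ, (i, j) ∈ squares → 1 ≤ i' → i' ≤ i → 1 ≤ j' → j' ≤ j →
    label (i', j') ≤ label (i, j)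
  label_le : ∀ s ∈ squares, label s ≤ n
  zero : squares.filter (fun s => label s = 0) = if X = .B then {(1, 1)} else ∅
  isDomino : ∀ k, 1 ≤ k → k ≤ n → ∃ i j : ℕ,
    squares.filter (fun s => label s = k) = {(i, j), (i + 1, j)} ∨
    squares.filter (fun s => label s = k) = {(i, j), (i, j + 1)}

namespace DominoTableau

variable {X : ClassicalType} {n : ℕ} (T : DominoTableau X n)

/-- The domino `D(k, T)`, as a set of squares. -/
def domino (k : ℕ) : Finset (ℕ × ℕ) := T.squares.filter (fun s => T.label s = k)

/-- The squares of `T(k)`, those with labels at most `k`. -/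
def upTo (k : ℕ) : Finset (ℕ × ℕ) := T.squares.filter (fun s => T.label s ≤ k)

/-- The shape of `T(k)`: the multiset of lengths of its nonempty rows. -/
def shapeUpTo (k : ℕ) : Multiset ℕ :=
  ((T.upTo k).image Prod.fst).val.map fun i => ((T.upTo k).filter (fun s => s.1 = i)).card

/-- `T` is admissible: the shape of each `T(k)` is the partition of a nilpotent orbit
of type `X`. -/
def Admissible : Prop := ∀ k ≤ n, IsNilpotentPartition X (T.shapeUpTo k)

/-- The label of an arbitrary position, with the usual conventions: `0` in row `0` and in
column `0`, and `∞` at the other positions outside `T`. -/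
noncomputable def extLabel (s : ℕ × ℕ) : ℕ∞ :=
  if s.1 = 0 ∨ s.2 = 0 then 0 else if s ∈ T.squares then (T.label s : ℕ∞) else ⊤

/-- The domino labelled `k` is vertical with upper square `(i, j)`. -/
def IsVertical (k i j : ℕ) : Prop := T.domino k = {(i, j), (i + 1, j)}

/-- The domino labelled `k` is horizontal with left square `(i, j)`. -/
def IsHorizontal (k i j : ℕ) : Prop := T.domino k = {(i, j), (i, j + 1)}

/-- Type `I⁺`: vertical, in a column `j` such that rows of length `j` may occur with odd
multiplicity. -/
def IsTypeIPlus (k : ℕ) : Prop := ∃ i j, T.IsVertical k i j ∧ (-1 : ℤ) ^ j = -X.eps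

/-- Type `I⁻`: vertical, in a column of the other parity. -/
def IsTypeIMinus (k : ℕ) : Prop := ∃ i j, T.IsVertical k i j ∧ (-1 : ℤ) ^ j = X.eps

/-- Type `N`: horizontal. -/
def IsTypeN (k : ℕ) : Prop := ∃ i j, T.IsHorizontal k i j

/-- `T.Joins k l`: when the domino `k` is added to `T(k - 1)`, it is put into the cluster
containing the label `l`. An `I⁻` domino joins the cluster on its left. An `I⁺` domino joins
the cluster above it if the row above has the same length in `T(k)`, and otherwise starts a new
cluster. An `N` domino joins the cluster on its left and also, if the row above has the same
length in `T(k)`, the one above its right square. The label `0` stands for the zero domino in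
type `B`, and for the positions to the left of the first column in type `C`. -/
inductive Joins : ℕ → ℕ → Prop
  | iMinus {k l i j : ℕ} (hv : T.IsVertical k i j) (hj : (-1 : ℤ) ^ j = X.eps)
      (hl : T.extLabel (i, j - 1) = l) : Joins k l
  | iPlus {k l i j : ℕ} (hv : T.IsVertical k i j) (hj : (-1 : ℤ) ^ j = -X.eps) (hi : 2 ≤ i)
      (hr : (k : ℕ∞) < T.extLabel (i - 1, j + 1)) (hl : T.extLabel (i - 1, j) = l) : Joins k l
  | nLeft {k l i j : ℕ} (hh : T.IsHorizontal k i j)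
      (hl : T.extLabel (i, j - 1) = l) : Joins k l
  | nAbove {k l i j : ℕ} (hh : T.IsHorizontal k i j) (hi : 2 ≤ i)
      (hr : (k : ℕ∞) < T.extLabel (i - 1, j + 2)) (hl : T.extLabel (i - 1, j + 1) = l) : Joins k l

/-- A cluster, as a set of labels of dominos: a class of the equivalence relation generated
by `Joins` (the label `0` is not recorded). -/
def IsCluster (K : Set ℕ) : Prop :=
  ∃ k, 1 ≤ k ∧ k ≤ n ∧ K = {l | 1 ≤ l ∧ l ≤ n ∧ Relation.EqvGen T.Joins k l}

/-- `K` is the cluster `cl(0)`, the one containing the domino `1` in types `B` and `C`. -/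
def IsClZero (K : Set ℕ) : Prop := T.IsCluster K ∧ (X = .B ∨ X = .C) ∧ 1 ∈ K

/-- The squares covered by the dominos with labels in `K`. -/
def squaresOf (K : Set ℕ) : Set (ℕ × ℕ) := {s | s ∈ T.squares ∧ T.label s ∈ K}

/-- `K` is an open cluster: it is not `cl(0)` and has an `I⁺` or `N` domino along its right
edge. -/
def IsOpenCluster (K : Set ℕ) : Prop :=
  T.IsCluster K ∧ ¬ T.IsClZero K ∧
    ∃ i j, (i, j) ∈ T.squaresOf K ∧ (∀ j', (i, j') ∈ T.squaresOf K → j' ≤ j) ∧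
      (T.IsTypeIPlus (T.label (i, j)) ∨ T.IsTypeN (T.label (i, j)))

/-- `K` is a closed cluster: it is neither `cl(0)` nor open. -/
def IsClosedCluster (K : Set ℕ) : Prop :=
  T.IsCluster K ∧ ¬ T.IsClZero K ∧ ¬ T.IsOpenCluster K

/-- The smallest label in a cluster, that is, the label of the domino `I_K`. -/
noncomputable def initialLabel (K : Set ℕ) : ℕ := sInf K

/-- `K` is a `Y`-cluster: it is a cluster, and the left and uppermost square `(i, j)` of its
domino of smallest label has `i + j` odd if `Y = B, C`, and `i + j` even if `Y = D, D'`; in other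
words, that square is `Y`-fixed. -/
def IsClusterOfType (Y : GridType) (K : Set ℕ) : Prop :=
  T.IsCluster K ∧ ∃ i j,
    (T.IsVertical (initialLabel K) i j ∨ T.IsHorizontal (initialLabel K) i j) ∧ Y.IsFixed (i, j)

/-- The square which, together with the fixed square `(i, j)` of the domino `k`, forms the
image of this domino under moving through. -/
noncomputable def newSquare (k i j : ℕ) : ℕ × ℕ :=
  open Classical in
  if T.domino k = {(i, j), (i + 1, j)} ∨ T.domino k = {(i, j), (i, j - 1)} then
    if (k : ℕ∞) < T.extLabel (i - 1, j + 1) then (i - 1, j) else (i, j + 1)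
  else
    if (k : ℕ∞) < T.extLabel (i + 1, j - 1) then (i, j - 1) else (i + 1, j)

/-- The image `MT(D(k, T), T)` of the domino `k` under the moving through map that keeps its
`Y`-fixed square, as a set of squares. -/
def MT (Y : GridType) (k : ℕ) : Set (ℕ × ℕ) :=
  {s | ∃ i j, (i, j) ∈ T.domino k ∧ Y.IsFixed (i, j) ∧ (s = (i, j) ∨ s = T.newSquare k i j)}

/-- The image of the domino `k` under moving through meets the domino `l`. -/
def Linked (Y : GridType) (k l : ℕ) : Prop :=
  1 ≤ k ∧ k ≤ n ∧ 1 ≤ l ∧ l ≤ n ∧ ∃ s ∈ T.MT Y k, s ∈ T.domino l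

/-- The `Y`-cycle of `T` through the domino `k`, as a set of labels. -/
def cycle (Y : GridType) (k : ℕ) : Set ℕ :=
  {l | 1 ≤ l ∧ l ≤ n ∧ Relation.EqvGen (T.Linked Y) k l}

/-- The initial cycle of a `Y`-cluster: the `Y`-cycle through its domino of smallest label. -/
noncomputable def initialCycle (Y : GridType) (K : Set ℕ) : Set ℕ := T.cycle Y (initialLabel K)

end DominoTableau

/-! The key notion is alignment (`IsAligned`): every horizontal domino is aligned, and a vertical
one is aligned when its `Y`-fixed square is the upper one for type I⁺ and the lower one for type I⁻.
Alignment is constant along a cycle, and links between aligned dominos stay inside one cluster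
(`IsAligned.of_linked`, `IsAligned.of_linked_symm`).

Admissibility enters through one fact: a horizontal domino has its left square in an I⁻ column.
Hence the fixed square of an aligned domino moves left or down in an I⁻ column, and up or right in
an I⁺ column. These are the directions of the cluster rules, which hold square by square: a square
in an I⁻ column belongs with its left neighbour, and one in an I⁺ column with the square above if
the upper right label is larger (`eqvGen_joins_left`, `eqvGen_joins_above`).

It remains to see that the initial domino is aligned. Its upper left square is fixed, so type I⁻
must be excluded: an I⁻ domino joins the label on its left, which is either a smaller label of the
same cluster, against minimality, or `0`, which forces the cluster to be cl(0). -/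

theorem GridType.isFixed_add_one_row (Y : GridType) (i j : ℕ) :
    Y.IsFixed (i + 1, j) ↔ ¬ Y.IsFixed (i, j) := by
  cases Y <;> simp only [GridType.IsFixed] <;> grind

theorem GridType.isFixed_add_one_col (Y : GridType) (i j : ℕ) :
    Y.IsFixed (i, j + 1) ↔ ¬ Y.IsFixed (i, j) := by
  cases Y <;> simp only [GridType.IsFixed] <;> grind

namespace ClassicalType

/-- The columns `j` which contain the `I⁻` dominos. -/
def IsMinusColumn (X : ClassicalType) (j : ℕ) : Prop := (-1 : ℤ) ^ j = X.eps

theorem not_isMinusColumn_iff (X : ClassicalType) (j : ℕ) :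
    ¬ X.IsMinusColumn j ↔ (-1 : ℤ) ^ j = -X.eps := by
  unfold IsMinusColumn
  rcases neg_one_pow_eq_or ℤ j with h | h <;> rw [h] <;> cases X <;> decide

theorem isMinusColumn_add_one (X : ClassicalType) (j : ℕ) :
    X.IsMinusColumn (j + 1) ↔ ¬ X.IsMinusColumn j := by
  rw [not_isMinusColumn_iff, IsMinusColumn, pow_succ, mul_neg_one, neg_eq_iff_eq_neg]

end ClassicalType

namespace DominoTableau

variable {X : ClassicalType} {n : ℕ} {T : DominoTableau X n}

/-! ### Squares, labels and dominos -/

theorem mem_domino {k : ℕ} {s : ℕ × ℕ} : s ∈ T.domino k ↔ s ∈ T.squares ∧ T.label s = k := by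
  simp [domino]

theorem IsVertical.mem_iff {k i j : ℕ} (h : T.IsVertical k i j) (s : ℕ × ℕ) :
    s ∈ T.domino k ↔ s = (i, j) ∨ s = (i + 1, j) := by
  rw [h]; simp

theorem IsHorizontal.mem_iff {k i j : ℕ} (h : T.IsHorizontal k i j) (s : ℕ × ℕ) :
    s ∈ T.domino k ↔ s = (i, j) ∨ s = (i, j + 1) := by
  rw [h]; simp

theorem IsVertical.not_isHorizontal {k i j i' j' : ℕ} (h : T.IsVertical k i j) :
    ¬ T.IsHorizontal k i' j' := by
  intro h'
  have h1 := (h'.mem_iff (i, j)).1 (by simp [h.mem_iff])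
  have h2 := (h'.mem_iff (i + 1, j)).1 (by simp [h.mem_iff])
  simp only [Prod.mk.injEq] at h1 h2
  omega

theorem IsVertical.unique {k i j i' j' : ℕ} (h : T.IsVertical k i j)
    (h' : T.IsVertical k i' j') : i = i' ∧ j = j' := by
  have h1 := (h'.mem_iff (i, j)).1 (by simp [h.mem_iff])
  have h2 := (h'.mem_iff (i + 1, j)).1 (by simp [h.mem_iff])
  simp only [Prod.mk.injEq] at h1 h2
  omega

theorem eq_of_mem_domino {k l : ℕ} {s : ℕ × ℕ} (h : s ∈ T.domino k) (h' : s ∈ T.domino l) :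
    k = l := by
  rw [mem_domino] at h h'
  exact h.2.symm.trans h'.2

theorem le_of_mem_domino {k l i j i' j' : ℕ} (h : (i, j) ∈ T.domino k)
    (h' : (i', j') ∈ T.domino l) (hi : i ≤ i') (hj : j ≤ j') : k ≤ l := by
  rw [mem_domino] at h h'
  rw [← h.2, ← h'.2]
  exact T.monotone _ _ _ _ h'.1 (T.pos _ h.1).1 hi (T.pos _ h.1).2 hj

theorem pos_of_mem_domino {k i j : ℕ} (h : (i, j) ∈ T.domino k) : 1 ≤ i ∧ 1 ≤ j :=
  T.pos _ (mem_domino.1 h).1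

theorem extLabel_of_mem_domino {k i j : ℕ} (h : (i, j) ∈ T.domino k) :
    T.extLabel (i, j) = k := by
  have hp := pos_of_mem_domino h
  rw [mem_domino] at h
  rw [extLabel, if_neg (by simp only; omega), if_pos h.1, h.2]

theorem mem_domino_label {s : ℕ × ℕ} (h : s ∈ T.squares) : s ∈ T.domino (T.label s) :=
  mem_domino.2 ⟨h, rfl⟩

/-- A position to the upper left of a domino with positive coordinates belongs to the tableau. -/
theorem exists_mem_domino {k i j i' j' : ℕ} (h : (i, j) ∈ T.domino k)
    (hi : 1 ≤ i') (hii : i' ≤ i) (hj : 1 ≤ j') (hjj : j' ≤ j) :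
    ∃ l, (i', j') ∈ T.domino l :=
  ⟨_, mem_domino_label (T.diagram _ _ _ _ (mem_domino.1 h).1 hi hii hj hjj)⟩

theorem le_of_mem_domino_le {k : ℕ} {s : ℕ × ℕ} (h : s ∈ T.domino k) : k ≤ n := by
  rw [mem_domino] at h
  exact h.2 ▸ T.label_le _ h.1

theorem mem_domino_zero {s : ℕ × ℕ} : s ∈ T.domino 0 ↔ X = .B ∧ s = (1, 1) := by
  have := T.zero
  rw [domino, this]
  split_ifs with h <;> simp [h]

/-- The four possible positions of a square in its domino. -/
theorem position_of_mem_domino {k a b : ℕ} (hk : 1 ≤ k) (h : (a, b) ∈ T.domino k) :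
    T.IsVertical k a b ∨ (∃ i, a = i + 1 ∧ T.IsVertical k i b) ∨
      T.IsHorizontal k a b ∨ ∃ j, b = j + 1 ∧ T.IsHorizontal k a j := by
  obtain ⟨i, j, hv | hh⟩ := T.isDomino k hk (le_of_mem_domino_le h)
  · have hv : T.IsVertical k i j := hv
    rw [hv.mem_iff] at h
    simp only [Prod.mk.injEq] at h
    rcases h with ⟨rfl, rfl⟩ | ⟨rfl, rfl⟩
    · exact .inl hv
    · exact .inr (.inl ⟨_, rfl, hv⟩)
  · have hh : T.IsHorizontal k i j := hh
    rw [hh.mem_iff] at h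
    simp only [Prod.mk.injEq] at h
    rcases h with ⟨rfl, rfl⟩ | ⟨rfl, rfl⟩
    · exact .inr (.inr (.inl hh))
    · exact .inr (.inr (.inr ⟨_, rfl, hh⟩))

theorem IsVertical.top_mem {k i j : ℕ} (h : T.IsVertical k i j) : (i, j) ∈ T.domino k := by
  simp [h.mem_iff]

theorem IsVertical.bottom_mem {k i j : ℕ} (h : T.IsVertical k i j) :
    (i + 1, j) ∈ T.domino k := by
  simp [h.mem_iff]

theorem IsHorizontal.left_mem {k i j : ℕ} (h : T.IsHorizontal k i j) : (i, j) ∈ T.domino k := by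
  simp [h.mem_iff]

theorem IsHorizontal.right_mem {k i j : ℕ} (h : T.IsHorizontal k i j) :
    (i, j + 1) ∈ T.domino k := by
  simp [h.mem_iff]

theorem IsVertical.one_le {k i j : ℕ} (h : T.IsVertical k i j) : 1 ≤ k := by
  by_contra hk
  obtain rfl : k = 0 := by omega
  have h1 := (mem_domino_zero.1 h.top_mem).2
  have h2 := (mem_domino_zero.1 h.bottom_mem).2
  simp only [Prod.mk.injEq] at h1 h2
  omega

theorem IsHorizontal.one_le {k i j : ℕ} (h : T.IsHorizontal k i j) : 1 ≤ k := by
  by_contra hk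
  obtain rfl : k = 0 := by omega
  have h1 := (mem_domino_zero.1 h.left_mem).2
  have h2 := (mem_domino_zero.1 h.right_mem).2
  simp only [Prod.mk.injEq] at h1 h2
  omega

/-! ### Admissibility and horizontal dominos -/

/-- Counting over all rows of `T` gives an index set independent of `k`, so that `T(k)` and `T(k -
1)` can be compared; empty rows do no harm because `l` is positive. -/
theorem count_shapeUpTo {k l : ℕ} (hl : 1 ≤ l) :
    (T.shapeUpTo k).count l = ((T.squares.image Prod.fst).filter
      fun i => ((T.upTo k).filter fun s => s.1 = i).card = l).card := by
  rw [shapeUpTo, Multiset.count_map, ← Finset.filter_val, Finset.card_val]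
  congr 1
  ext i
  simp only [Finset.mem_filter, Finset.mem_image]
  constructor
  · rintro ⟨⟨s, hs, rfl⟩, h⟩
    exact ⟨⟨s, (Finset.mem_filter.1 hs).1, rfl⟩, h.symm⟩
  · rintro ⟨-, h⟩
    obtain ⟨s, hs⟩ := Finset.card_pos.1 (h.symm ▸ hl : 0 < _)
    rw [Finset.mem_filter] at hs
    exact ⟨⟨s, hs⟩, h.symm⟩

theorem mem_upTo {k : ℕ} {s : ℕ × ℕ} : s ∈ T.upTo k ↔ s ∈ T.squares ∧ T.label s ≤ k := by
  simp [upTo]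

theorem IsHorizontal.card_row {k i j : ℕ} (h : T.IsHorizontal k i j) :
    ((T.upTo k).filter fun s => s.1 = i).card = j + 1 := by
  have hr := mem_domino.1 h.right_mem
  have hp := T.pos _ hr.1
  have : ((T.upTo k).filter fun s => s.1 = i) = (Finset.Icc 1 (j + 1)).image fun b => (i, b) := by
    ext ⟨a, b⟩
    simp only [Finset.mem_filter, mem_upTo, Finset.mem_image, Finset.mem_Icc, Prod.mk.injEq]
    constructor
    · rintro ⟨⟨hs, hle⟩, rfl⟩
      refine ⟨b, ⟨(T.pos _ hs).2, ?_⟩, rfl, rfl⟩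
      by_contra hb
      have hge := T.monotone _ _ a (j + 1) hs hp.1 le_rfl hp.2 (by omega)
      have hm : (a, b) ∈ T.domino k := mem_domino.2 ⟨hs, by omega⟩
      rw [h.mem_iff] at hm
      simp only [Prod.mk.injEq] at hm
      omega
    · rintro ⟨b, hb, rfl, rfl⟩
      refine ⟨⟨T.diagram _ _ _ _ hr.1 hp.1 le_rfl hb.1 hb.2, ?_⟩, rfl⟩
      exact (T.monotone _ _ _ _ hr.1 hp.1 le_rfl hb.1 hb.2).trans hr.2.le
  rw [this, Finset.card_image_of_injective _ fun _ _ h => (Prod.mk.inj h).2]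
  simp

/-- In an admissible tableau the horizontal dominos start in the columns of the `I⁻` dominos. -/
theorem IsHorizontal.isMinusColumn {k i j : ℕ} (h : T.IsHorizontal k i j) (hT : T.Admissible) :
    X.IsMinusColumn j := by
  have hk := h.one_le
  have hr := mem_domino.1 h.right_mem
  have hl := mem_domino.1 h.left_mem
  have hkn := le_of_mem_domino_le h.left_mem
  by_contra hj
  rw [← X.isMinusColumn_add_one] at hj
  have h1 := (hT k hkn).2 (j + 1) hj
  have h2 := (hT (k - 1) (by omega)).2 (j + 1) hj
  rw [count_shapeUpTo (by omega)] at h1 h2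
  have hi : ((T.upTo (k - 1)).filter fun s => s.1 = i).card < j + 1 := by
    rw [← h.card_row]
    refine Finset.card_lt_card ⟨fun s => ?_, fun hsub => ?_⟩
    · simp only [Finset.mem_filter, mem_upTo]
      rintro ⟨⟨hs, hle⟩, rfl⟩
      exact ⟨⟨hs, by omega⟩, rfl⟩
    · have := @hsub (i, j) (by simp [mem_upTo, hl])
      simp only [Finset.mem_filter, mem_upTo] at this
      omega
  -- Adding the domino creates exactly one new row of length `j + 1`, so the multiplicity of this
  -- part cannot be even both before and after.
  have key : ((T.squares.image Prod.fst).filter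
        fun a => ((T.upTo k).filter fun s => s.1 = a).card = j + 1) =
      insert i ((T.squares.image Prod.fst).filter
        fun a => ((T.upTo (k - 1)).filter fun s => s.1 = a).card = j + 1) := by
    ext a
    rw [Finset.mem_insert, Finset.mem_filter, Finset.mem_filter]
    by_cases ha : a = i
    · subst ha
      simp only [h.card_row, true_or, and_true, iff_true]
      exact Finset.mem_image_of_mem _ hl.1
    · have : ((T.upTo k).filter fun s => s.1 = a) = (T.upTo (k - 1)).filter fun s => s.1 = a := by
        ext s
        simp only [Finset.mem_filter, mem_upTo]
        refine and_congr_left fun hs => and_congr_right fun hs' => ⟨fun hle => ?_, by omega⟩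
        have hne : T.label s ≠ k := fun he => by
          have hm := mem_domino.2 ⟨hs', he⟩
          rw [h.mem_iff] at hm
          rcases hm with rfl | rfl <;> exact ha hs.symm
        omega
      rw [this]
      simp [ha]
  rw [key, Finset.card_insert_of_notMem (by simp only [Finset.mem_filter]; omega)] at h1
  grind

/-! ### Clusters, square by square -/

theorem one_le_of_mem_domino {k i j : ℕ} (hk : (i, j) ∈ T.domino k) (hj : X.IsMinusColumn j) :
    1 ≤ k := by
  by_contra hk0
  obtain rfl : k = 0 := by omega
  obtain ⟨rfl, h⟩ := mem_domino_zero.1 hk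
  obtain ⟨rfl, rfl⟩ := Prod.mk.inj h
  revert hj
  simp [ClassicalType.IsMinusColumn, ClassicalType.eps]

/-- The label of a square in another column is in the cluster of the label above it if the
square to the upper right has a larger label. -/
theorem eqvGen_joins_above (hT : T.Admissible) {k l i j : ℕ} (hk : (i + 1, j) ∈ T.domino k)
    (hl : (i, j) ∈ T.domino l) (hj : ¬ X.IsMinusColumn j)
    (hr : (k : ℕ∞) < T.extLabel (i, j + 1)) : Relation.EqvGen T.Joins k l := by
  have hp := pos_of_mem_domino hl
  have hk1 : 1 ≤ k := by
    by_contra hk0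
    obtain rfl : k = 0 := by omega
    have := (mem_domino_zero.1 hk).2
    simp only [Prod.mk.injEq] at this
    omega
  rcases position_of_mem_domino hk1 hk with hv | ⟨i', hi', hv⟩ | hh | ⟨j', rfl, hh⟩
  · exact .rel _ _ (.iPlus hv ((X.not_isMinusColumn_iff j).1 hj) (by omega) hr
      (extLabel_of_mem_domino hl))
  · obtain rfl : i = i' := by omega
    rw [eq_of_mem_domino hv.top_mem hl]
    exact .refl _
  · exact absurd (hh.isMinusColumn hT) hj
  · exact .rel _ _ (.nAbove hh (by omega) hr (extLabel_of_mem_domino hl))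

/-- The label of a square in an `I⁻` column is in the cluster of the label on its left. -/
theorem eqvGen_joins_left (hT : T.Admissible) {k l i j : ℕ} (hk : (i, j + 1) ∈ T.domino k)
    (hj : X.IsMinusColumn (j + 1)) (hl : T.extLabel (i, j) = l) : Relation.EqvGen T.Joins k l := by
  have hk1 := one_le_of_mem_domino hk hj
  rcases position_of_mem_domino hk1 hk with hv | ⟨i, rfl, hv⟩ | hh | ⟨j', hj', hh⟩
  · exact .rel _ _ (.iMinus hv hj hl)
  · have hp := pos_of_mem_domino hv.top_mem
    -- The rule only mentions the left neighbour of the upper square. The left neighbour of the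
    -- lower square is in the same cluster: both are `0` in front of column 1, and otherwise
    -- `eqvGen_joins_above` applies, with `k` as the upper right label.
    rcases Nat.eq_zero_or_pos j with rfl | hj0
    · refine .rel _ _ (.iMinus hv hj ?_)
      simpa [extLabel] using hl
    · obtain ⟨a, ha⟩ := exists_mem_domino hv.top_mem hp.1 le_rfl hj0 (by omega)
      obtain ⟨b, hb⟩ := exists_mem_domino hv.bottom_mem (by omega) le_rfl hj0 (Nat.le_succ j)
      rw [extLabel_of_mem_domino hb, Nat.cast_inj] at hl
      subst hl
      refine .trans _ a _ (.rel _ _ (.iMinus hv hj (extLabel_of_mem_domino ha))) (.symm _ _ ?_)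
      refine eqvGen_joins_above hT hb ha ((X.isMinusColumn_add_one j).1 hj) ?_
      rw [extLabel_of_mem_domino hv.top_mem, Nat.cast_lt]
      refine lt_of_le_of_ne (le_of_mem_domino hb hv.bottom_mem le_rfl (Nat.le_succ j)) ?_
      rintro rfl
      rw [hv.mem_iff] at hb
      simp at hb
  · exact .rel _ _ (.nLeft hh hl)
  · obtain rfl : j = j' := by omega
    exact absurd (hh.isMinusColumn hT) ((X.isMinusColumn_add_one j).1 hj)

theorem notMem_domino_of_antidiagonal {k i j : ℕ} (hk1 : 1 ≤ k) (h : (i, j + 1) ∈ T.domino k) :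
    (i + 1, j) ∉ T.domino k := by
  intro h'
  rcases position_of_mem_domino hk1 h with hv | ⟨i', rfl, hv⟩ | hh | ⟨j', hj', hh⟩
  · simp [hv.mem_iff] at h'
  · simp [hv.mem_iff] at h'
  · simp [hh.mem_iff] at h'
  · simp [hh.mem_iff] at h'

/-! ### Aligned dominos -/

variable (T) in
/-- The domino `k` is horizontal, or it is vertical and its `Y`-fixed square is the upper one
if and only if it has type `I⁺`. -/
def IsAligned (Y : GridType) (k : ℕ) : Prop :=
  ∀ i j, T.IsVertical k i j → (X.IsMinusColumn j ↔ ¬ Y.IsFixed (i, j))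

/-- A single nonfixed square tests alignment: it must not be the top of an I⁺ domino nor the bottom
of an I⁻ domino. -/
theorem isAligned_of_not_isFixed {Y : GridType} {l a b : ℕ} (h : (a, b) ∈ T.domino l)
    (hF : ¬ Y.IsFixed (a, b)) (h1 : ¬ X.IsMinusColumn b → (a + 1, b) ∉ T.domino l)
    (h2 : X.IsMinusColumn b → ∀ a', a = a' + 1 → (a', b) ∉ T.domino l) : T.IsAligned Y l := by
  intro i j hv
  rw [hv.mem_iff, Prod.mk.injEq, Prod.mk.injEq] at h
  rcases h with ⟨rfl, rfl⟩ | ⟨rfl, rfl⟩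
  · simp only [hF, not_false_eq_true, iff_true]
    by_contra hj
    exact h1 hj hv.bottom_mem
  · rw [Y.isFixed_add_one_row, not_not] at hF
    simp only [hF, not_true_eq_false, iff_false]
    exact fun hj => h2 hj _ rfl hv.top_mem

theorem IsAligned.mem_of_isMinusColumn (hT : T.Admissible) {Y : GridType} {l a b : ℕ}
    (hl : T.IsAligned Y l) (h : (a, b) ∈ T.domino l) (hF : ¬ Y.IsFixed (a, b))
    (hb : X.IsMinusColumn b) : (a + 1, b) ∈ T.domino l ∨ (a, b + 1) ∈ T.domino l := by
  rcases position_of_mem_domino (one_le_of_mem_domino h hb) h with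
    hv | ⟨i, rfl, hv⟩ | hh | ⟨j, rfl, hh⟩
  · exact .inl hv.bottom_mem
  · rw [Y.isFixed_add_one_row] at hF
    exact absurd ((hl _ _ hv).1 hb) hF
  · exact .inr hh.right_mem
  · exact absurd (hh.isMinusColumn hT) ((X.isMinusColumn_add_one j).1 hb)

theorem IsAligned.mem_of_not_isMinusColumn (hT : T.Admissible) {Y : GridType} {l a b : ℕ}
    (hl : T.IsAligned Y l) (hl1 : 1 ≤ l) (h : (a + 1, b + 1) ∈ T.domino l)
    (hF : ¬ Y.IsFixed (a + 1, b + 1)) (hb : ¬ X.IsMinusColumn (b + 1)) :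
    (a, b + 1) ∈ T.domino l ∨ (a + 1, b) ∈ T.domino l := by
  rcases position_of_mem_domino hl1 h with hv | ⟨i, hi, hv⟩ | hh | ⟨j, hj, hh⟩
  · exact absurd ((hl _ _ hv).2 hF) hb
  · obtain rfl : a = i := by omega
    exact .inl hv.top_mem
  · exact absurd (hh.isMinusColumn hT) hb
  · obtain rfl : b = j := by omega
    exact .inr hh.left_mem

/-! ### Moving through and alignment -/

theorem newSquare_of_lower_or_left {k i j : ℕ}
    (h : (i + 2, j + 1) ∈ T.domino k ∨ (i + 1, j) ∈ T.domino k)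
    (hk : (i + 1, j + 1) ∈ T.domino k) (hk1 : 1 ≤ k) :
    T.newSquare k (i + 1) (j + 1) =
      if (k : ℕ∞) < T.extLabel (i, j + 2) then (i, j + 1) else (i + 1, j + 2) := by
  rw [newSquare, if_pos]
  · rfl
  rcases position_of_mem_domino hk1 hk with hv | ⟨i', hi, hv⟩ | hh | ⟨j', hj, hh⟩
  · exact .inl hv
  · rw [hv.mem_iff, hv.mem_iff] at h
    simp only [Prod.mk.injEq] at h
    omega
  · rw [hh.mem_iff, hh.mem_iff] at h
    simp only [Prod.mk.injEq] at h
    omega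
  · obtain rfl : j = j' := by omega
    refine .inr (Eq.trans hh ?_)
    rw [Finset.pair_comm]
    rfl

theorem newSquare_of_upper_or_right {k i j : ℕ}
    (h : (i, j + 1) ∈ T.domino k ∨ (i + 1, j + 2) ∈ T.domino k) :
    T.newSquare k (i + 1) (j + 1) =
      if (k : ℕ∞) < T.extLabel (i + 2, j) then (i + 1, j) else (i + 2, j + 1) := by
  rw [newSquare, if_neg]
  · rfl
  rintro (h' | h') <;>
    (rw [h'] at h; simp only [Finset.mem_insert, Finset.mem_singleton, Prod.mk.injEq] at h; omega)

/-- A domino is linked to itself and to the one containing the new square of its image. -/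
theorem Linked.eq_or_newSquare_mem {Y : GridType} {k l : ℕ} (h : T.Linked Y k l) :
    k = l ∨ ∃ i j, (i + 1, j + 1) ∈ T.domino k ∧ Y.IsFixed (i + 1, j + 1) ∧
      T.newSquare k (i + 1) (j + 1) ∈ T.domino l := by
  obtain ⟨-, -, -, -, s, ⟨i, j, hk, hF, rfl | rfl⟩, hs⟩ := h
  · exact .inl (eq_of_mem_domino hk hs)
  · obtain ⟨hi, hj⟩ := pos_of_mem_domino hk
    obtain ⟨i, rfl⟩ := Nat.exists_eq_add_of_le' hi
    obtain ⟨j, rfl⟩ := Nat.exists_eq_add_of_le' hj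
    exact .inr ⟨i, j, hk, hF, hs⟩

/-- If the fixed square of an aligned domino is in a column of `I⁺` dominos, then moving through
takes place at its upper right corner. -/
theorem IsAligned.lower_or_left_mem {Y : GridType} {k i j : ℕ} (hT : T.Admissible)
    (hk : T.IsAligned Y k) (hk1 : 1 ≤ k) (h : (i + 1, j + 1) ∈ T.domino k)
    (hF : Y.IsFixed (i + 1, j + 1)) (hj : ¬ X.IsMinusColumn (j + 1)) :
    (i + 2, j + 1) ∈ T.domino k ∨ (i + 1, j) ∈ T.domino k := by
  rcases position_of_mem_domino hk1 h with hv | ⟨i', hi, hv⟩ | hh | ⟨j', hj', hh⟩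
  · exact .inl hv.bottom_mem
  · obtain rfl : i = i' := by omega
    exact absurd ((hk _ _ hv).2 ((Y.isFixed_add_one_row _ _).1 hF)) hj
  · exact absurd (hh.isMinusColumn hT) hj
  · obtain rfl : j = j' := by omega
    exact .inr hh.left_mem

/-- If the fixed square of an aligned domino is in a column of `I⁻` dominos, then moving through
takes place at its lower left corner. -/
theorem IsAligned.upper_or_right_mem {Y : GridType} {k i j : ℕ} (hT : T.Admissible)
    (hk : T.IsAligned Y k) (hk1 : 1 ≤ k) (h : (i + 1, j + 1) ∈ T.domino k)
    (hF : Y.IsFixed (i + 1, j + 1)) (hj : X.IsMinusColumn (j + 1)) :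
    (i, j + 1) ∈ T.domino k ∨ (i + 1, j + 2) ∈ T.domino k := by
  rcases position_of_mem_domino hk1 h with hv | ⟨i', hi, hv⟩ | hh | ⟨j', hj', hh⟩
  · exact absurd hF ((hk _ _ hv).1 hj)
  · obtain rfl : i = i' := by omega
    exact .inl hv.top_mem
  · exact .inr hh.right_mem
  · obtain rfl : j = j' := by omega
    exact absurd (hh.isMinusColumn hT) ((X.isMinusColumn_add_one _).1 hj)

/-- Moving through an aligned domino leads to an aligned domino of the same cluster. -/
theorem IsAligned.of_linked (hT : T.Admissible) {Y : GridType} {k l : ℕ}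
    (hk : T.IsAligned Y k) (h : T.Linked Y k l) :
    T.IsAligned Y l ∧ Relation.EqvGen T.Joins k l := by
  obtain rfl | hne := eq_or_ne k l
  · exact ⟨hk, .refl _⟩
  have hk1 := h.1
  obtain ⟨i, j, hm, hF, hs⟩ := h.eq_or_newSquare_mem.resolve_left hne
  have notMem : ∀ {s}, s ∈ T.domino k → s ∉ T.domino l := fun h h' => hne (eq_of_mem_domino h h')
  have hc := X.isMinusColumn_add_one j
  have hc' := X.isMinusColumn_add_one (j + 1)
  by_cases hj : X.IsMinusColumn (j + 1)
  · rw [newSquare_of_upper_or_right (hk.upper_or_right_mem hT hk1 hm hF hj)] at hs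
    split_ifs at hs with hlt
    · refine ⟨isAligned_of_not_isFixed hs ((Y.isFixed_add_one_col _ _).1 hF) (fun _ h' => ?_)
        (fun h' => absurd h' (hc.1 hj)), eqvGen_joins_left hT hm hj (extLabel_of_mem_domino hs)⟩
      rw [extLabel_of_mem_domino h', Nat.cast_lt] at hlt
      exact hlt.not_ge (le_of_mem_domino hs hm le_rfl (Nat.le_succ j))
    · have hF' : ¬ Y.IsFixed (i + 2, j + 1) := by
        rw [Y.isFixed_add_one_row]
        exact not_not.2 hF
      refine ⟨isAligned_of_not_isFixed hs hF' (fun h' => absurd hj h') fun _ a ha => ?_, ?_⟩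
      · obtain rfl : i + 1 = a := by omega
        exact notMem hm
      -- A downward move is matched by a detour through the left column: `k` to `a`, down to `b`,
      -- then to `l`. The test that sent the domino down says that `b` is at most `k`, which is what
      -- links `b` to `a`. In column 1 the label `0` plays this role.
      rcases Nat.eq_zero_or_pos j with rfl | hj0
      · exact .trans _ 0 _ (eqvGen_joins_left hT hm hj (by simp [extLabel]))
          (.symm _ _ (eqvGen_joins_left hT hs hj (by simp [extLabel])))
      · obtain ⟨a, ha⟩ := exists_mem_domino hm (by omega) le_rfl hj0 (Nat.le_succ j)
        obtain ⟨b, hb⟩ := exists_mem_domino hs (by omega) le_rfl hj0 (Nat.le_succ j)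
        refine .trans _ a _ (eqvGen_joins_left hT hm hj (extLabel_of_mem_domino ha)) ?_
        refine .trans _ b _ (.symm _ _ (eqvGen_joins_above hT hb ha (hc.1 hj) ?_))
          (.symm _ _ (eqvGen_joins_left hT hs hj (extLabel_of_mem_domino hb)))
        rw [extLabel_of_mem_domino hb, not_lt, Nat.cast_le] at hlt
        rw [extLabel_of_mem_domino hm, Nat.cast_lt]
        refine lt_of_le_of_ne hlt ?_
        rintro rfl
        exact notMem_domino_of_antidiagonal hk1 hm hb
  · rw [newSquare_of_lower_or_left (hk.lower_or_left_mem hT hk1 hm hF hj) hm hk1] at hs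
    split_ifs at hs with hlt
    · refine ⟨isAligned_of_not_isFixed hs ((Y.isFixed_add_one_row _ _).1 hF)
        (fun _ => notMem hm) (fun h' => absurd h' hj), eqvGen_joins_above hT hm hs hj hlt⟩
    · have hF' : ¬ Y.IsFixed (i + 1, j + 2) := by
        rw [Y.isFixed_add_one_col]
        exact not_not.2 hF
      refine ⟨isAligned_of_not_isFixed hs hF' (fun h' => absurd (hc'.2 hj) h') ?_,
        .symm _ _ (eqvGen_joins_left hT hs (hc'.2 hj) (extLabel_of_mem_domino hm))⟩
      -- Were the upper right square in `l`, the failed test would give `l ≤ k`, while monotonicity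
      -- along the row gives `k ≤ l`.
      intro _ a ha h'
      obtain rfl : i = a := by omega
      rw [extLabel_of_mem_domino h', Nat.cast_lt, not_lt] at hlt
      exact hne (le_antisymm (le_of_mem_domino hm hs le_rfl (Nat.le_succ _)) hlt)

/-- Only aligned dominos lead to an aligned domino by moving through. -/
theorem IsAligned.of_linked_symm (hT : T.Admissible) {Y : GridType} {k l : ℕ}
    (hl : T.IsAligned Y l) (h : T.Linked Y k l) : T.IsAligned Y k := by
  obtain rfl | hne := eq_or_ne k l
  · exact hl
  obtain ⟨hk1, -, hl1, -, -⟩ := id h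
  obtain ⟨i, j, hm, hF, hs⟩ := h.eq_or_newSquare_mem.resolve_left hne
  have notMem : ∀ {s}, s ∈ T.domino k → s ∉ T.domino l := fun h h' => hne (eq_of_mem_domino h h')
  have hc := X.isMinusColumn_add_one j
  have hc' := X.isMinusColumn_add_one (j + 1)
  intro a b hv
  have hm' := hm
  rw [hv.mem_iff, Prod.mk.injEq, Prod.mk.injEq] at hm'
  rcases hm' with ⟨rfl, rfl⟩ | ⟨ha, rfl⟩
  · simp only [hF, not_true_eq_false, iff_false]
    intro hj
    rw [newSquare_of_lower_or_left (.inl hv.bottom_mem) hm hk1] at hs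
    split_ifs at hs with hlt
    · rcases hl.mem_of_isMinusColumn hT hs ((Y.isFixed_add_one_row _ _).1 hF) hj with h' | h'
      · exact notMem hm h'
      · rw [extLabel_of_mem_domino h', Nat.cast_lt] at hlt
        exact hlt.not_ge (le_of_mem_domino hs hm (Nat.le_succ i) le_rfl)
    · have hF' : ¬ Y.IsFixed (i + 1, j + 2) := by
        rw [Y.isFixed_add_one_col]
        exact not_not.2 hF
      rcases hl.mem_of_not_isMinusColumn hT hl1 hs hF' (by rw [hc', not_not]; exact hj)
        with h' | h'
      · rw [extLabel_of_mem_domino h', Nat.cast_lt, not_lt] at hlt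
        exact hne (le_antisymm (le_of_mem_domino hm hs le_rfl (Nat.le_succ _)) hlt)
      · exact notMem hm h'
  · obtain rfl : i = a := by omega
    have hFi := (Y.isFixed_add_one_row _ _).1 hF
    simp only [hFi, not_false_eq_true, iff_true]
    by_contra hj
    rw [newSquare_of_upper_or_right (.inl hv.top_mem)] at hs
    split_ifs at hs with hlt
    · rcases hl.mem_of_isMinusColumn hT hs ((Y.isFixed_add_one_col _ _).1 hF)
        (not_not.1 (mt hc.2 hj)) with h' | h'
      · rw [extLabel_of_mem_domino h', Nat.cast_lt] at hlt
        exact hlt.not_ge (le_of_mem_domino hs hm le_rfl (Nat.le_succ j))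
      · exact notMem hm h'
    · have hF' : ¬ Y.IsFixed (i + 2, j + 1) := by
        rw [Y.isFixed_add_one_row]
        exact not_not.2 hF
      rcases hl.mem_of_not_isMinusColumn hT hl1 hs hF' hj with h' | h'
      · exact notMem hm h'
      · rw [extLabel_of_mem_domino h', Nat.cast_lt, not_lt] at hlt
        exact hne (le_antisymm (le_of_mem_domino hm hs (Nat.le_succ _) le_rfl) hlt)

/-- Cycles traverse links in both directions, so alignment has to pass both ways before the cluster
relation can be chained. -/
theorem IsAligned.of_eqvGen_linked (hT : T.Admissible) {Y : GridType} {k l : ℕ}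
    (h : Relation.EqvGen (T.Linked Y) k l) :
    (T.IsAligned Y k ↔ T.IsAligned Y l) ∧ (T.IsAligned Y k → Relation.EqvGen T.Joins k l) := by
  induction h with
  | rel k l h =>
    exact ⟨⟨fun hk => (hk.of_linked hT h).1, fun hl => hl.of_linked_symm hT h⟩,
      fun hk => (hk.of_linked hT h).2⟩
  | refl k => exact ⟨.rfl, fun _ => .refl _⟩
  | symm k l _ ih => exact ⟨ih.1.symm, fun hl => .symm _ _ (ih.2 (ih.1.2 hl))⟩
  | trans k l m _ _ ih ih' =>
    exact ⟨ih.1.trans ih'.1, fun hk => .trans _ _ _ (ih.2 hk) (ih'.2 (ih.1.1 hk))⟩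

/-! ### The initial domino -/

/-- In types `B` and `C` the label `0` is linked to the domino with label `1`. -/
theorem eqvGen_joins_one_zero (hT : T.Admissible) (hX : X = .B ∨ X = .C) (hn : 1 ≤ n) :
    Relation.EqvGen T.Joins 1 0 := by
  obtain ⟨s, hs⟩ : ∃ s, s ∈ T.domino 1 := by
    obtain ⟨i, j, h | h⟩ := T.isDomino 1 le_rfl hn <;> exact ⟨(i, j), by simp [domino, h]⟩
  obtain ⟨a, b⟩ := s
  obtain ⟨ha, hb⟩ := pos_of_mem_domino hs
  obtain ⟨o, ho⟩ := exists_mem_domino hs le_rfl ha le_rfl hb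
  have ho1 := le_of_mem_domino ho hs ha hb
  rcases hX with rfl | rfl
  · have h0 : (1, 1) ∈ T.domino 0 := mem_domino_zero.2 ⟨rfl, rfl⟩
    -- Everything weakly to the upper left of a square labelled `1` has label `0` or `1`, and only
    -- the corner has label `0`.
    have key : ∀ {i j}, 1 ≤ i → i ≤ a → 1 ≤ j → j ≤ b → (i, j) ≠ (1, 1) →
        (i, j) ∈ T.domino 1 := by
      intro i j hi hia hj hjb hij
      obtain ⟨c, hc⟩ := exists_mem_domino hs hi hia hj hjb
      have := le_of_mem_domino hc hs hia hjb
      obtain rfl | rfl : c = 0 ∨ c = 1 := by omega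
      · exact absurd (mem_domino_zero.1 hc).2 hij
      · exact hc
    have hab : (a, b) ≠ (1, 1) := by
      rintro h
      rw [h] at hs
      exact absurd (eq_of_mem_domino hs h0) one_ne_zero
    rw [Ne, Prod.mk.injEq] at hab
    by_cases ha2 : 2 ≤ a
    · have h2 : (2, 1) ∈ T.domino 1 := key (by omega) ha2 le_rfl hb (by simp)
      refine eqvGen_joins_above hT h2 h0 (by simp [ClassicalType.IsMinusColumn,
        ClassicalType.eps]) ?_
      by_cases hm : (1, 2) ∈ T.squares
      · have hm := mem_domino_label hm
        rw [extLabel_of_mem_domino hm, Nat.cast_lt]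
        by_contra hlt
        obtain h | h : T.label (1, 2) = 0 ∨ T.label (1, 2) = 1 := by omega
        · rw [h] at hm
          simpa using (mem_domino_zero.1 hm).2
        · rw [h] at hm
          exact notMem_domino_of_antidiagonal le_rfl hm h2
      · simp [extLabel, hm]
    · have h2 : (1, 2) ∈ T.domino 1 := key le_rfl ha (by omega) (by omega) (by simp)
      exact eqvGen_joins_left hT h2 (by simp [ClassicalType.IsMinusColumn, ClassicalType.eps])
        (extLabel_of_mem_domino h0)
  · obtain rfl | rfl : o = 0 ∨ o = 1 := by omega
    · simpa using mem_domino_zero.1 ho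
    · exact eqvGen_joins_left hT ho (by simp [ClassicalType.IsMinusColumn, ClassicalType.eps])
        (by simp [extLabel])

theorem initialLabel_mem {K : Set ℕ} (hK : T.IsCluster K) : initialLabel K ∈ K := by
  obtain ⟨k, hk, hkn, rfl⟩ := hK
  exact Nat.sInf_mem ⟨k, hk, hkn, .refl _⟩

/-- The initial domino of a cluster other than `cl(0)` is not in a column of `I⁻` dominos
if it is vertical. -/
theorem IsVertical.not_isMinusColumn_of_initialLabel (hT : T.Admissible) {K : Set ℕ}
    (hK : T.IsCluster K) (h0 : ¬ T.IsClZero K) {i j : ℕ}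
    (hv : T.IsVertical (initialLabel K) i j) : ¬ X.IsMinusColumn j := by
  intro hj
  have hm := initialLabel_mem hK
  obtain ⟨k, hk, hkn, hKk⟩ := id hK
  have hle : ∀ l ∈ K, initialLabel K ≤ l := fun l hl => Nat.sInf_le hl
  generalize initialLabel K = m at *
  have hm' := hm
  rw [hKk] at hm'
  obtain ⟨-, hmn, hkm⟩ := hm'
  have hp := pos_of_mem_domino hv.top_mem
  obtain ⟨j, rfl⟩ := Nat.exists_eq_add_of_le' hp.2
  have zero : Relation.EqvGen T.Joins m 0 → X = .B ∨ X = .C → False := by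
    intro hm0 hX
    refine h0 ⟨hK, hX, ?_⟩
    rw [hKk]
    exact ⟨le_rfl, by omega, .trans _ _ _ (.trans _ _ _ hkm hm0)
      (.symm _ _ (eqvGen_joins_one_zero hT hX (by omega)))⟩
  rcases Nat.eq_zero_or_pos j with rfl | hj0
  -- Column 1 is an I⁻ column only in type `C`.
  · refine zero (eqvGen_joins_left hT hv.top_mem hj (by simp [extLabel])) (.inr ?_)
    revert hj
    cases X <;> simp [ClassicalType.IsMinusColumn, ClassicalType.eps]
  · obtain ⟨l, hl⟩ := exists_mem_domino hv.top_mem hp.1 le_rfl hj0 (Nat.le_succ j)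
    have hml := eqvGen_joins_left hT hv.top_mem hj (extLabel_of_mem_domino hl)
    have hlm := le_of_mem_domino hl hv.top_mem le_rfl (Nat.le_succ j)
    rcases Nat.eq_zero_or_pos l with rfl | hl0
    · exact zero hml (.inl (mem_domino_zero.1 hl).1)
    · have hlK : l ∈ K := by
        rw [hKk]
        exact ⟨hl0, by omega, .trans _ _ _ hkm hml⟩
      obtain rfl := le_antisymm hlm (hle l hlK)
      rw [hv.mem_iff] at hl
      simp at hl

end DominoTableau

theorem mainTheorem4 (X : ClassicalType) (n : ℕ) (T : DominoTableau X n) (hT : T.Admissible)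
    (K : Set ℕ) (hK : T.IsOpenCluster K ∨ T.IsClosedCluster K)
    (Y : GridType) (hY : T.IsClusterOfType Y K) :
    T.initialCycle Y K ⊆ K := by
  have h0 : ¬ T.IsClZero K := hK.elim (fun h => h.2.1) (fun h => h.2.1)
  obtain ⟨hc, i, j, hpos, hF⟩ := hY
  have hm := DominoTableau.initialLabel_mem hc
  have hgood : T.IsAligned Y (DominoTableau.initialLabel K) := by
    intro a b hv
    rcases hpos with hv' | hh
    · obtain ⟨rfl, rfl⟩ := hv.unique hv'
      simp only [hF, not_true_eq_false, iff_false]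
      exact hv.not_isMinusColumn_of_initialLabel hT hc h0
    · exact absurd hh hv.not_isHorizontal
  rintro l ⟨hl1, hln, hl⟩
  have hj := (DominoTableau.IsAligned.of_eqvGen_linked hT hl).2 hgood
  obtain ⟨k, -, -, hKk⟩ := hc
  have hmem (x : ℕ) : x ∈ K ↔ 1 ≤ x ∧ x ≤ n ∧ Relation.EqvGen T.Joins k x := by rw [hKk]; rfl
  exact (hmem l).2 ⟨hl1, hln, .trans _ _ _ ((hmem _).1 hm).2.2 hj⟩
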